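/- Let $n\ge 0$ and $\bar n=\{1,\dots,n\}$. Let $PB_n$ be the pure braid group on $n$ strands, i.e. the kernel of the canonical homomorphism $B_n\to S_n$, $s_k\mapsto (k\;k{+}1)$, where $B_n$ is the Artin braid group with generators $s_1,\dots,s_{n-1}$ and relations $s_ks_l=s_ls_k$ for $|k-l|\ge 2$, $s_ks_{k+1}s_k=s_{k+1}s_ks_{k+1}$. For $1\le i<j\le n$ let $$b_{ij}=(s_is_{i+1}\cdots s_{j-2})\,s_{j-1}^2\,(s_is_{i+1}\cdots s_{j-2})^{-1}\in PB_n$$ (words are read from left to right: the $i$-th point passes its neighbours $i+1,\dots,j-1$, makes a full turn around the $j$-th point in the same sense of rotation, and returns the way it came); these are the standard generators of $PB_n$. Let $\widetilde G_n^3$ be the group generated by the letters $a_{ijk}=a_{\{i,j,k\}}$ for the three-element subsets $\{i,j,k\}\subset\bar n$ and the letters $\sigma_{ij}$ for the ordered pairs of distinct $i,j\in\bar n$, with the relations * $a_{ijk}^2=1$; * $a_{ijk}a_{stu}=a_{stu}a_{ijk}$ if $|\{i,j,k\}\cap\{s,t,u\}|<2$; * $a_{ijk}a_{ijl}a_{ikl}a_{jkl}=a_{jkl}a_{ikl}a_{ijl}a_{ijk}$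 for distinct $i,j,k,l$; * $\sigma_{ij}\sigma_{kl}=\sigma_{kl}\sigma_{ij}$ for distinct $i,j,k,l$; * $\sigma_{ij}a_{stu}=a_{stu}\sigma_{ij}$ if $|\{i,j\}\cap\{s,t,u\}|<2$; * for distinct $i,j,k$: $a_{ijk}\sigma_{ij}\sigma_{ik}\sigma_{jk}=\sigma_{jk}\sigma_{ik}\sigma_{ij}a_{ijk}$, $\;\sigma_{ij}a_{ijk}\sigma_{ik}\sigma_{jk}=\sigma_{jk}\sigma_{ik}a_{ijk}\sigma_{ij}$, $\;\sigma_{ij}\sigma_{ik}a_{ijk}\sigma_{jk}=\sigma_{jk}a_{ijk}\sigma_{ik}\sigma_{ij}$, $\;\sigma_{ij}\sigma_{ik}\sigma_{jk}a_{ijk}=a_{ijk}\sigma_{jk}\sigma_{ik}\sigma_{ij}$. For $i<j$ put, omitting the factor with $k=i$ in every product over $k<j$, $$c_{i,j}=(a_{ij(j+1)}a_{ij(j+2)}\cdots a_{ijn})\,\sigma_{ij}^{-1}\,(a_{ij1}a_{ij2}\cdots a_{ij(j-1)}),$$ $$\bar c_{i,j}=(a_{ij(j-1)}\cdots a_{ij2}a_{ij1})\,\sigma_{ij}\,(a_{ijn}\cdots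 a_{ij(j+2)}a_{ij(j+1)}),\qquad \bar c_{j,i}=(a_{ij(j-1)}\cdots a_{ij2}a_{ij1})\,\sigma_{ji}\,(a_{ijn}\cdots a_{ij(j+2)}a_{ij(j+1)}).$$ Then there is a group homomorphism $\widetilde\phi:PB_n\to\widetilde G_n^3$ such that for all $i<j$ $$\widetilde\phi(b_{ij})=c_{i,i+1}^{-1}c_{i,i+2}^{-1}\cdots c_{i,j-1}^{-1}\,\bar c_{i,j}\,\bar c_{j,i}\,c_{i,j-1}\cdots c_{i,i+2}c_{i,i+1}.$$ In other words, if two words in the letters $b_{ij}^{\pm1}$ represent the same element of $PB_n$, then the words obtained from them by the above substitution represent the same element of $\widetilde G_n^3$. -/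

import Mathlib

/-! ### Braid groups and pure braid groups -/

/-- Artin's relations between the generators `s_k` (strands are numbered from `0` to `n - 1`;
`s_k` exchanges the strands in the positions `k` and `k + 1`). -/
inductive BraidRel (n : ℕ) : FreeGroup (Fin (n - 1)) → Prop
  | comm (k l : Fin (n - 1)) (h : k.val + 2 ≤ l.val) :
      BraidRel n (FreeGroup.of k * FreeGroup.of l * (FreeGroup.of l * FreeGroup.of k)⁻¹)
  | braid (k l : Fin (n - 1)) (h : k.val + 1 = l.val) :
      BraidRel n (FreeGroup.of k * FreeGroup.of l * FreeGroup.of k *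
        (FreeGroup.of l * FreeGroup.of k * FreeGroup.of l)⁻¹)

/-- The Artin braid group on `n` strands. -/
abbrev BraidGroup (n : ℕ) : Type := PresentedGroup {r | BraidRel n r}

namespace BraidGroup

/-- The Artin generator `s_k`. -/
def s {n : ℕ} (k : Fin (n - 1)) : BraidGroup n := PresentedGroup.of k

/-- The transposition of the positions `k` and `k + 1`. -/
def adjSwap {n : ℕ} (k : Fin (n - 1)) : Equiv.Perm (Fin n) :=
  Equiv.swap ⟨k.val, by omega⟩ ⟨k.val + 1, by omega⟩

theorem adjSwap_rel {n : ℕ} (r : FreeGroup (Fin (n - 1))) (hr : r ∈ {r | BraidRel n r}) :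
    FreeGroup.lift (adjSwap (n := n)) r = 1 := by
  rcases hr with ⟨k, l, h⟩ | ⟨k, l, h⟩
  · simp only [map_mul, map_inv, FreeGroup.lift_apply_of, mul_inv_eq_one]
    refine (Equiv.Perm.disjoint_swap_swap ?_).commute
    simp [Fin.ext_iff]
    omega
  · simp only [map_mul, map_inv, FreeGroup.lift_apply_of, mul_inv_eq_one]
    have key : ∀ p q r : Fin n, p ≠ q → p ≠ r → q ≠ r →
        Equiv.swap p q * Equiv.swap q r * Equiv.swap p q =
          Equiv.swap q r * Equiv.swap p q * Equiv.swap q r := by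
      intro p q r hpq hpr hqr
      rw [Equiv.swap_mul_swap_mul_swap hpq hpr, Equiv.swap_comm p q, Equiv.swap_comm q r,
        Equiv.swap_mul_swap_mul_swap hqr.symm hpr.symm, Equiv.swap_comm]
    obtain ⟨l, hl⟩ := l
    subst h
    exact key _ _ _ (by simp) (by simp [Fin.ext_iff]; omega) (by simp)

/-- The homomorphism from the braid group to the symmetric group. -/
def perm (n : ℕ) : BraidGroup n →* Equiv.Perm (Fin n) :=
  PresentedGroup.toGroup adjSwap_rel

/-- The product `s_i s_{i+1} ⋯ s_{j-2}` (the empty product if `j = i + 1`). -/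
def run {n : ℕ} (i j : Fin n) : BraidGroup n :=
  (((List.finRange (n - 1)).filter fun k => i.val ≤ k.val ∧ k.val + 1 < j.val).map s).prod

/-- The braid `b_{ij} = (s_i ⋯ s_{j-2}) s_{j-1}^2 (s_i ⋯ s_{j-2})⁻¹`: the point `i` passes its
neighbours `i + 1, …, j - 1` on one side, makes a full turn around the point `j` in the same
sense of rotation, and goes back the way it came. Words are read from left to right. -/
def b {n : ℕ} (i j : Fin n) (h : i < j) : BraidGroup n :=
  run i j * s ⟨j.val - 1, by omega⟩ ^ 2 * (run i j)⁻¹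

theorem perm_b {n : ℕ} (i j : Fin n) (h : i < j) : perm n (b i j h) = 1 := by
  simp only [b, map_mul, map_inv, map_pow, perm, s, PresentedGroup.toGroup.of]
  simp [adjSwap, pow_two]

end BraidGroup

/-- The pure braid group on `n` strands. -/
abbrev PureBraidGroup (n : ℕ) : Type := (BraidGroup.perm n).ker

/-- The generator `b_{ij}`, `i < j`, of the pure braid group. -/
def PureBraidGroup.b {n : ℕ} (i j : Fin n) (h : i < j) : PureBraidGroup n :=
  ⟨BraidGroup.b i j h, BraidGroup.perm_b i j h⟩

/-! ### The group with generators `a_{ijk}` and `σ_{ij}` -/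

/-- The generators: `a_t` for the three-element sets `t` of indices (so `a_{ijk}` does not depend
on the order of `i, j, k`), and `σ_{ij}` for the ordered pairs of distinct indices. -/
inductive TildeGen (n : ℕ) : Type
  | a (t : Finset (Fin n)) (h : t.card = 3) : TildeGen n
  | σ (i j : Fin n) (h : i ≠ j) : TildeGen n

namespace TildeGen

/-- The letter `a_t`; it is only used for sets with three elements. -/
def A {n : ℕ} (t : Finset (Fin n)) : FreeGroup (TildeGen n) :=
  if h : t.card = 3 then FreeGroup.of (.a t h) else 1

/-- The letter `σ_{ij}`; it is only used for `i ≠ j`. -/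
def S {n : ℕ} (i j : Fin n) : FreeGroup (TildeGen n) :=
  if h : i ≠ j then FreeGroup.of (.σ i j h) else 1

end TildeGen

open TildeGen in
/-- The defining relations `u = v`, written as `u v⁻¹`. -/
inductive TildeRel (n : ℕ) : FreeGroup (TildeGen n) → Prop
  | a_sq (t : Finset (Fin n)) (ht : t.card = 3) : TildeRel n (A t ^ 2)
  | a_comm (t u : Finset (Fin n)) (ht : t.card = 3) (hu : u.card = 3) (h : (t ∩ u).card < 2) :
      TildeRel n (A t * A u * (A u * A t)⁻¹)
  | tetra (i j k l : Fin n) (h : [i, j, k, l].Nodup) :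
      TildeRel n (A {i, j, k} * A {i, j, l} * A {i, k, l} * A {j, k, l} *
        (A {j, k, l} * A {i, k, l} * A {i, j, l} * A {i, j, k})⁻¹)
  | σ_comm (i j k l : Fin n) (h : [i, j, k, l].Nodup) :
      TildeRel n (S i j * S k l * (S k l * S i j)⁻¹)
  | σ_a_comm (i j : Fin n) (t : Finset (Fin n)) (hij : i ≠ j) (ht : t.card = 3)
      (h : (({i, j} : Finset (Fin n)) ∩ t).card < 2) :
      TildeRel n (S i j * A t * (A t * S i j)⁻¹)
  | mixed₁ (i j k : Fin n) (h : [i, j, k].Nodup) :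
      TildeRel n (A {i, j, k} * S i j * S i k * S j k *
        (S j k * S i k * S i j * A {i, j, k})⁻¹)
  | mixed₂ (i j k : Fin n) (h : [i, j, k].Nodup) :
      TildeRel n (S i j * A {i, j, k} * S i k * S j k *
        (S j k * S i k * A {i, j, k} * S i j)⁻¹)
  | mixed₃ (i j k : Fin n) (h : [i, j, k].Nodup) :
      TildeRel n (S i j * S i k * A {i, j, k} * S j k *
        (S j k * A {i, j, k} * S i k * S i j)⁻¹)
  | mixed₄ (i j k : Fin n) (h : [i, j, k].Nodup) :
      TildeRel n (S i j * S i k * S j k * A {i, j, k} *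
        (A {i, j, k} * S j k * S i k * S i j)⁻¹)

/-- The group `G̃_n^3`. -/
abbrev TildeG (n : ℕ) : Type := PresentedGroup {r | TildeRel n r}

namespace TildeG

/-- The element `a_{ijk}`, for distinct `i, j, k`. -/
def a {n : ℕ} (i j k : Fin n) : TildeG n := PresentedGroup.mk _ (TildeGen.A {i, j, k})

/-- The element `σ_{ij}`, for distinct `i, j`. -/
def σ {n : ℕ} (i j : Fin n) : TildeG n := PresentedGroup.mk _ (TildeGen.S i j)

/-- The indices smaller than `j` and different from `i`, in increasing order. -/
def below {n : ℕ} (i j : Fin n) : List (Fin n) :=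
  (List.finRange n).filter fun k => k < j ∧ k ≠ i

/-- The indices larger than `j`, in increasing order. -/
def above {n : ℕ} (j : Fin n) : List (Fin n) :=
  (List.finRange n).filter fun k => j < k

/-- `c_{ij} = (a_{ij(j+1)} ⋯ a_{ijn}) σ_{ij}⁻¹ (a_{ij1} ⋯ a_{ij(j-1)})` for `i < j`. -/
def c {n : ℕ} (i j : Fin n) : TildeG n :=
  ((above j).map (a i j)).prod * (σ i j)⁻¹ * ((below i j).map (a i j)).prod

/-- `(a_{ij(j-1)} ⋯ a_{ij1}) g (a_{ijn} ⋯ a_{ij(j+1)})` for `i < j`. -/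
def bar {n : ℕ} (i j : Fin n) (g : TildeG n) : TildeG n :=
  ((below i j).reverse.map (a i j)).prod * g * ((above j).reverse.map (a i j)).prod

/-- `c̄_{ij}` for `i < j`. -/
def cbar {n : ℕ} (i j : Fin n) : TildeG n := bar i j (σ i j)

/-- `c̄_{ji}` for `i < j` (the smaller index is the first argument). -/
def cbarSwap {n : ℕ} (i j : Fin n) : TildeG n := bar i j (σ j i)

/-- The indices strictly between `i` and `j`, in increasing order. -/
def between {n : ℕ} (i j : Fin n) : List (Fin n) :=
  (List.finRange n).filter fun k => i < k ∧ k < j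

/-- The image of `b_{ij}`, `i < j`:
`c_{i,i+1}⁻¹ ⋯ c_{i,j-1}⁻¹ c̄_{ij} c̄_{ji} c_{i,j-1} ⋯ c_{i,i+1}`. -/
def phi {n : ℕ} (i j : Fin n) : TildeG n :=
  ((between i j).map fun k => (c i k)⁻¹).prod * cbar i j * cbarSwap i j *
    ((between i j).reverse.map fun k => c i k).prod

end TildeG

namespace TildeG

open TildeGen

variable {n : ℕ}

/-! The map on pure braids is the restriction of one defined on the whole braid group. The symmetric
group acts on `TildeG n` by renaming indices (`rename`), and `twistedHom` sends `s_k` to the pair of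
`cbar k (k+1)` and the transposition of `k` and `k+1` in the semidirect product. The permutation
accumulated by a prefix of a braid word sends a position to the original label of the point there,
so the twisted multiplication writes every later crossing in original labels. On pure braids the
permutation is trivial, and the first component becomes multiplicative.

Artin's relations are checked in the first component. For three neighbouring points
(`crossing_braid`), one letter `a x y z` must pass through three crossings and reverse their order:
`aProd_triple`, coming from the tetrahedron relation, handles the letters `a`, and `σ_triple`
handles the letters `σ`. For two distant pairs (`crossing_comm`), all factors commute except four
letters `a` on the four points involved, and these are exchanged by one tetrahedron relation.

Finally, the prefix `run i j` brings the point `i` to the position `j - 1` and keeps the others in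
order (`IsShift`). Hence the two factors `s_{j-1}` of `b i j` become `cbar i j` and `cbarSwap i j`,
conjugated by the crossings of `i` with the points passed on the way (`twistedHom_b`). -/

theorem mk_eq_of_rel {u v : FreeGroup (TildeGen n)} (h : TildeRel n (u * v⁻¹)) :
    PresentedGroup.mk {r | TildeRel n r} u = PresentedGroup.mk _ v := by
  rw [← mul_inv_eq_one, ← map_inv, ← map_mul]
  exact PresentedGroup.one_of_mem h

/-! #### The defining relations as equations -/

theorem a_swap₁₂ (i j k : Fin n) : a i j k = a j i k := by
  rw [a, a, Finset.insert_comm]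

theorem a_swap₂₃ (i j k : Fin n) : a i j k = a i k j := by
  rw [a, a, Finset.pair_comm]

theorem card_triple {i j k : Fin n} (h : [i, j, k].Nodup) :
    ({i, j, k} : Finset (Fin n)).card = 3 := by
  simp only [List.nodup_cons, List.mem_cons, not_or] at h
  exact Finset.card_eq_three.2 ⟨i, j, k, h.1.1, h.1.2.1, h.2.1.1, rfl⟩

theorem a_mul_self {i j k : Fin n} (h : [i, j, k].Nodup) : a i j k * a i j k = 1 := by
  rw [← pow_two, a, ← map_pow]
  exact PresentedGroup.one_of_mem (TildeRel.a_sq _ (card_triple h))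

theorem a_inv {i j k : Fin n} (h : [i, j, k].Nodup) : (a i j k)⁻¹ = a i j k :=
  inv_eq_of_mul_eq_one_left (a_mul_self h)

theorem commute_a_a {i j k p q r : Fin n} (h : [i, j, k].Nodup) (h' : [p, q, r].Nodup)
    (hc : (({i, j, k} : Finset (Fin n)) ∩ {p, q, r}).card < 2) : Commute (a i j k) (a p q r) := by
  have := mk_eq_of_rel (TildeRel.a_comm _ _ (card_triple h) (card_triple h') hc)
  simp only [map_mul] at this
  exact this

theorem commute_σ_a {i j p q r : Fin n} (h : i ≠ j) (h' : [p, q, r].Nodup)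
    (hc : (({i, j} : Finset (Fin n)) ∩ {p, q, r}).card < 2) : Commute (σ i j) (a p q r) := by
  have := mk_eq_of_rel (TildeRel.σ_a_comm i j _ h (card_triple h') hc)
  simp only [map_mul] at this
  exact this

theorem commute_σ_σ {i j k l : Fin n} (h : [i, j, k, l].Nodup) : Commute (σ i j) (σ k l) := by
  have := mk_eq_of_rel (TildeRel.σ_comm i j k l h)
  simp only [map_mul] at this
  exact this

theorem tetrahedron {i j k l : Fin n} (h : [i, j, k, l].Nodup) :
    a i j k * a i j l * a i k l * a j k l = a j k l * a i k l * a i j l * a i j k := by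
  have := mk_eq_of_rel (TildeRel.tetra i j k l h)
  simp only [map_mul] at this
  exact this

theorem σ_triple {i j k : Fin n} (h : [i, j, k].Nodup) :
    σ i j * σ i k * σ j k * a i j k = a i j k * σ j k * σ i k * σ i j := by
  have := mk_eq_of_rel (TildeRel.mixed₄ i j k h)
  simp only [map_mul] at this
  exact this

theorem card_pair_inter_lt_two {i j : Fin n} {t : Finset (Fin n)} (h : i ∉ t ∨ j ∉ t) :
    (({i, j} : Finset (Fin n)) ∩ t).card < 2 := by
  refine Nat.lt_succ_of_le (Finset.card_le_one.2 ?_)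
  simp only [Finset.mem_inter, Finset.mem_insert, Finset.mem_singleton]
  grind

theorem card_triple_inter_lt_two {i j k : Fin n} {t : Finset (Fin n)} (hk : k ∉ t)
    (h : i ∉ t ∨ j ∉ t) : (({i, j, k} : Finset (Fin n)) ∩ t).card < 2 := by
  have := card_pair_inter_lt_two h
  rwa [show ({i, j, k} : Finset (Fin n)) ∩ t = {i, j} ∩ t by
    ext; simp only [Finset.mem_inter, Finset.mem_insert, Finset.mem_singleton]; grind]

/-! #### The action of permutations of the indices -/

/-- The generator with its indices renamed by a permutation. -/
def renameAux (π : Equiv.Perm (Fin n)) : TildeGen n → TildeG n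
  | .a t _ => PresentedGroup.mk _ (A (t.map π.toEmbedding))
  | .σ i j _ => PresentedGroup.mk _ (S (π i) (π j))

theorem lift_renameAux_A (π : Equiv.Perm (Fin n)) (t : Finset (Fin n)) :
    FreeGroup.lift (renameAux π) (A t) = PresentedGroup.mk _ (A (t.map π.toEmbedding)) := by
  by_cases h : t.card = 3
  · rw [A, dif_pos h, FreeGroup.lift_apply_of, renameAux]
  -- Off three-element sets `A` takes the default value 1, and renaming preserves cardinality.
  · rw [A, dif_neg h, A, dif_neg (by rwa [Finset.card_map]), map_one, map_one]

theorem lift_renameAux_S (π : Equiv.Perm (Fin n)) (i j : Fin n) :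
    FreeGroup.lift (renameAux π) (S i j) = PresentedGroup.mk _ (S (π i) (π j)) := by
  by_cases h : i ≠ j
  · rw [S, dif_pos h, FreeGroup.lift_apply_of, renameAux]
  · rw [S, dif_neg h, S, dif_neg (by simpa using h), map_one, map_one]

/-- Each family of relations is constrained only by coincidences among indices, which a permutation
preserves; relators therefore go to relators of the same family. -/
theorem renameAux_rel (π : Equiv.Perm (Fin n)) (r : FreeGroup (TildeGen n))
    (hr : r ∈ {r | TildeRel n r}) : FreeGroup.lift (renameAux π) r = 1 := by
  have nd {l : List (Fin n)} (h : l.Nodup) : (l.map π).Nodup := h.map π.injective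
  rcases hr with ⟨t, ht⟩ | ⟨t, u, ht, hu, h⟩ | ⟨i, j, k, l, h⟩ | ⟨i, j, k, l, h⟩ |
    ⟨i, j, t, hij, ht, h⟩ | ⟨i, j, k, h⟩ | ⟨i, j, k, h⟩ | ⟨i, j, k, h⟩ | ⟨i, j, k, h⟩ <;>
  simp only [map_mul, map_inv, map_pow, lift_renameAux_A, lift_renameAux_S, Finset.map_insert,
    Finset.map_singleton, Equiv.coe_toEmbedding] <;>
  simp only [← map_mul, ← map_inv, ← map_pow] <;>
  apply PresentedGroup.one_of_mem
  · exact .a_sq _ (by simpa)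
  · exact .a_comm _ _ (by simpa) (by simpa) (by rwa [← Finset.map_inter, Finset.card_map])
  · exact .tetra _ _ _ _ (nd h)
  · exact .σ_comm _ _ _ _ (nd h)
  · refine .σ_a_comm _ _ _ (by simpa) (by simpa) ?_
    have : ({π i, π j} : Finset (Fin n)) = ({i, j} : Finset (Fin n)).map π.toEmbedding := by simp
    rwa [this, ← Finset.map_inter, Finset.card_map]
  · exact .mixed₁ _ _ _ (nd h)
  · exact .mixed₂ _ _ _ (nd h)
  · exact .mixed₃ _ _ _ (nd h)
  · exact .mixed₄ _ _ _ (nd h)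

/-- The endomorphism of `TildeG n` that renames the indices by a permutation. -/
def renameHom (π : Equiv.Perm (Fin n)) : TildeG n →* TildeG n :=
  PresentedGroup.toGroup (renameAux_rel π)

theorem renameHom_mk_A (π : Equiv.Perm (Fin n)) (t : Finset (Fin n)) :
    renameHom π (PresentedGroup.mk _ (A t)) = PresentedGroup.mk _ (A (t.map π.toEmbedding)) :=
  lift_renameAux_A π t

theorem renameHom_mk_S (π : Equiv.Perm (Fin n)) (i j : Fin n) :
    renameHom π (PresentedGroup.mk _ (S i j)) = PresentedGroup.mk _ (S (π i) (π j)) :=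
  lift_renameAux_S π i j

theorem hom_ext_A_S {f g : TildeG n →* TildeG n}
    (hA : ∀ t, f (PresentedGroup.mk _ (A t)) = g (PresentedGroup.mk _ (A t)))
    (hS : ∀ i j, f (PresentedGroup.mk _ (S i j)) = g (PresentedGroup.mk _ (S i j))) : f = g := by
  refine PresentedGroup.ext fun x => ?_
  rcases x with ⟨t, h⟩ | ⟨i, j, h⟩
  · have := hA t
    rwa [A, dif_pos h] at this
  · have := hS i j
    rwa [S, dif_pos h] at this

theorem renameHom_one : renameHom (1 : Equiv.Perm (Fin n)) = MonoidHom.id _ := by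
  refine hom_ext_A_S (fun t => ?_) (fun i j => ?_)
  · rw [renameHom_mk_A, show t.map (Equiv.toEmbedding 1) = t from Finset.map_refl]
    rfl
  · rw [renameHom_mk_S]
    rfl

theorem renameHom_mul (π ρ : Equiv.Perm (Fin n)) :
    renameHom (π * ρ) = (renameHom π).comp (renameHom ρ) := by
  refine hom_ext_A_S (fun t => ?_) (fun i j => ?_)
  · rw [MonoidHom.comp_apply]
    simp only [renameHom_mk_A]
    rw [Finset.map_map]
    rfl
  · rw [MonoidHom.comp_apply]
    simp only [renameHom_mk_S]
    rfl

/-- The action of the symmetric group on `TildeG n` by renaming the indices. -/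
def rename (n : ℕ) : Equiv.Perm (Fin n) →* MulAut (TildeG n) where
  toFun π := MonoidHom.toMulEquiv (renameHom π) (renameHom π⁻¹)
    (by rw [← renameHom_mul, inv_mul_cancel, renameHom_one])
    (by rw [← renameHom_mul, mul_inv_cancel, renameHom_one])
  map_one' := by
    ext x
    exact DFunLike.congr_fun renameHom_one x
  map_mul' π ρ := by
    ext x
    exact DFunLike.congr_fun (renameHom_mul π ρ) x

theorem rename_a (π : Equiv.Perm (Fin n)) (i j k : Fin n) :
    rename n π (a i j k) = a (π i) (π j) (π k) := by
  refine (renameHom_mk_A π _).trans ?_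
  simp [a]

theorem rename_σ (π : Equiv.Perm (Fin n)) (i j : Fin n) :
    rename n π (σ i j) = σ (π i) (π j) :=
  renameHom_mk_S π i j

/-! #### Crossings -/

/-- The product of the letters `a_{ijk}`, where `k` runs through a list. -/
def aProd (i j : Fin n) (l : List (Fin n)) : TildeG n := (l.map (a i j)).prod

/-- The crossing of the adjacent points `i` and `j`, where the points on one side of them are
listed in `l` and the points on the other side in `r`. -/
def crossing (l r : List (Fin n)) (i j : Fin n) : TildeG n := aProd i j l * σ i j * aProd i j r

@[simp] theorem aProd_nil (i j : Fin n) : aProd i j [] = 1 := rfl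

@[simp] theorem aProd_cons (i j k : Fin n) (l : List (Fin n)) :
    aProd i j (k :: l) = a i j k * aProd i j l := by simp [aProd]

@[simp] theorem aProd_append (i j : Fin n) (l l' : List (Fin n)) :
    aProd i j (l ++ l') = aProd i j l * aProd i j l' := by simp [aProd]

theorem aProd_comm (i j : Fin n) (l : List (Fin n)) : aProd i j l = aProd j i l := by
  rw [aProd, aProd]
  congr 2
  exact funext fun k => a_swap₁₂ i j k

theorem rename_aProd (π : Equiv.Perm (Fin n)) (i j : Fin n) (l : List (Fin n)) :
    rename n π (aProd i j l) = aProd (π i) (π j) (l.map π) := by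
  induction l with
  | nil => simp
  | cons k l ih => simp [ih, rename_a]

theorem rename_crossing (π : Equiv.Perm (Fin n)) (l r : List (Fin n)) (i j : Fin n) :
    rename n π (crossing l r i j) = crossing (l.map π) (r.map π) (π i) (π j) := by
  simp only [crossing, map_mul, rename_aProd, rename_σ]

theorem commute_aProd {g : TildeG n} {i j : Fin n} {l : List (Fin n)}
    (h : ∀ k ∈ l, Commute g (a i j k)) : Commute g (aProd i j l) := by
  refine Commute.list_prod_right _ _ fun x hx => ?_
  obtain ⟨k, hk, rfl⟩ := List.mem_map.1 hx
  exact h k hk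

theorem aProd_inv {i j : Fin n} {l : List (Fin n)} (h : ∀ k ∈ l, [i, j, k].Nodup) :
    (aProd i j l)⁻¹ = aProd i j l.reverse := by
  induction l with
  | nil => simp
  | cons k l ih =>
    rw [List.reverse_cons, aProd_append, aProd_cons, mul_inv_rev,
      ih fun m hm => h m (List.mem_cons_of_mem _ hm), a_inv (h k List.mem_cons_self)]
    simp

/-! #### The braid relation for crossings -/

/-- The varying third points differ, and neither lies in the pair of the other triple; two such
triples share at most the one point common to the two pairs. -/
theorem commute_aProd_aProd {i j p q : Fin n} {l r : List (Fin n)} (hij : i ≠ j) (hpq : p ≠ q)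
    (h : s(i, j) ≠ s(p, q)) (hl : ∀ w ∈ l, w ∉ [i, j, p, q]) (hr : ∀ w ∈ r, w ∉ [i, j, p, q])
    (hd : l.Disjoint r) : Commute (aProd i j l) (aProd p q r) := by
  refine commute_aProd fun v hv => (commute_aProd fun w hw => Commute.symm ?_).symm
  have hwv : w ≠ v := fun e => hd hw (e ▸ hv)
  have hw := hl w hw
  have hv := hr v hv
  simp only [List.mem_cons, List.not_mem_nil, ne_eq, Sym2.eq_iff] at hw hv h
  refine commute_a_a (by simp; grind) (by simp; grind) (card_triple_inter_lt_two ?_ ?_) <;>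
  simp only [Finset.mem_insert, Finset.mem_singleton] <;> grind

theorem commute_σ_aProd {i j p q : Fin n} {l : List (Fin n)} (hij : i ≠ j) (hpq : p ≠ q)
    (h : s(i, j) ≠ s(p, q)) (hl : ∀ w ∈ l, w ∉ [i, j, p, q]) :
    Commute (σ i j) (aProd p q l) := by
  refine commute_aProd fun v hv => ?_
  have hv := hl v hv
  simp only [List.mem_cons, List.not_mem_nil, ne_eq, Sym2.eq_iff] at hv h
  refine commute_σ_a hij (by simp; grind) (card_pair_inter_lt_two ?_)
  simp only [Finset.mem_insert, Finset.mem_singleton]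
  grind

/-- For one point `w` this is the tetrahedron relation on `x, y, z, w`. Letters with different third
points and different pairs commute, so a longer list can be treated one point at a time. -/
theorem aProd_triple {x y z : Fin n} {l : List (Fin n)} (h : (x :: y :: z :: l).Nodup) :
    aProd x y l * aProd x z l * aProd y z l * a x y z =
      a x y z * (aProd y z l * aProd x z l * aProd x y l) := by
  induction l with
  | nil => simp
  | cons w l ih =>
    have ih := ih (by simp at h ⊢; grind)
    have T := tetrahedron (i := x) (j := y) (k := z) (l := w) (by simp at h ⊢; grind)
    have hxyz : [x, y, z].Nodup := by simp at h ⊢; grind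
    have hA := a_mul_self hxyz
    have comm {i j p q : Fin n} (hij : i ∈ [x, y, z]) (hj : j ∈ [x, y, z]) (hp : p ∈ [x, y, z])
        (hq : q ∈ [x, y, z]) (hij : i ≠ j) (hpq : p ≠ q) (hne : s(i, j) ≠ s(p, q)) :
        aProd i j l * a p q w = a p q w * aProd i j l := by
      have : Commute (aProd i j l) (aProd p q [w]) :=
        commute_aProd_aProd hij hpq hne (by simp at *; grind) (by simp at *; grind)
          (by simp at *; grind)
      simpa using this.eq
    have c1 : aProd x y l * a x z w = a x z w * aProd x y l :=
      comm (by simp) (by simp) (by simp) (by simp) (by grind) (by grind) (by simp; grind)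
    have c2 : aProd x y l * a y z w = a y z w * aProd x y l :=
      comm (by simp) (by simp) (by simp) (by simp) (by grind) (by grind) (by simp; grind)
    have c3 : aProd x z l * a y z w = a y z w * aProd x z l :=
      comm (by simp) (by simp) (by simp) (by simp) (by grind) (by grind) (by simp; grind)
    have c4 : aProd y z l * a x z w = a x z w * aProd y z l :=
      comm (by simp) (by simp) (by simp) (by simp) (by grind) (by grind) (by simp; grind)
    have c5 : aProd y z l * a x y w = a x y w * aProd y z l :=
      comm (by simp) (by simp) (by simp) (by simp) (by grind) (by grind) (by simp; grind)
    have c6 : aProd x z l * a x y w = a x y w * aProd x z l :=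
      comm (by simp) (by simp) (by simp) (by simp) (by grind) (by grind) (by simp; grind)
    -- The tetrahedron relation multiplied by the involution `a x y z` on both sides.
    have T' : a x y w * a x z w * a y z w * a x y z = a x y z * (a y z w * a x z w * a x y w) := by
      calc _ = a x y z * (a x y z * a x y w * a x z w * a y z w) * a x y z := by
            simp only [← mul_assoc, hA, one_mul]
        _ = a x y z * (a y z w * a x z w * a x y w) * (a x y z * a x y z) := by
            rw [T]; simp only [mul_assoc]
        _ = _ := by rw [hA, mul_one]
    simp only [aProd_cons]
    calc _ = a x y w * (aProd x y l * a x z w) * (aProd x z l * a y z w) * aProd y z l *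
          a x y z := by simp only [mul_assoc]
      _ = a x y w * a x z w * (aProd x y l * a y z w) * aProd x z l * aProd y z l * a x y z := by
          rw [c1, c3]; simp only [mul_assoc]
      _ = a x y w * a x z w * a y z w * (aProd x y l * aProd x z l * aProd y z l * a x y z) := by
          rw [c2]; simp only [mul_assoc]
      _ = (a x y w * a x z w * a y z w * a x y z) *
          (aProd y z l * aProd x z l * aProd x y l) := by rw [ih]; simp only [mul_assoc]
      _ = a x y z * a y z w * a x z w * (a x y w * aProd y z l) * aProd x z l * aProd x y l := by
          rw [T']; simp only [mul_assoc]
      _ = a x y z * a y z w * (a x z w * aProd y z l) * (a x y w * aProd x z l) * aProd x y l := by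
          rw [← c5]; simp only [mul_assoc]
      _ = _ := by rw [← c4, ← c6]; simp only [mul_assoc]

/-- Factors belonging to different pairs and to different kinds (`l`, `σ`, `r`) commute, so the
product can be sorted by kind while the order of the pairs is kept. -/
theorem crossing_mul_crossing_mul_crossing {x₁ y₁ x₂ y₂ x₃ y₃ : Fin n} {l r : List (Fin n)}
    (h12 : x₁ ≠ y₁) (h34 : x₂ ≠ y₂) (h56 : x₃ ≠ y₃)
    (n1 : s(x₁, y₁) ≠ s(x₂, y₂)) (n2 : s(x₁, y₁) ≠ s(x₃, y₃)) (n3 : s(x₂, y₂) ≠ s(x₃, y₃))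
    (hl : ∀ w ∈ l, w ∉ [x₁, y₁, x₂, y₂, x₃, y₃]) (hr : ∀ w ∈ r, w ∉ [x₁, y₁, x₂, y₂, x₃, y₃])
    (hlr : r.Disjoint l) :
    crossing l r x₁ y₁ * crossing l r x₂ y₂ * crossing l r x₃ y₃ =
      (aProd x₁ y₁ l * aProd x₂ y₂ l * aProd x₃ y₃ l) * (σ x₁ y₁ * σ x₂ y₂ * σ x₃ y₃) *
        (aProd x₁ y₁ r * aProd x₂ y₂ r * aProd x₃ y₃ r) := by
  simp only [List.mem_cons, List.not_mem_nil, or_false, not_or] at hl hr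
  have ca {i j p q : Fin n} (hij : i ≠ j) (hpq : p ≠ q) (hne : s(i, j) ≠ s(p, q))
      (hml : ∀ w ∈ l, w ∉ [i, j, p, q]) (hmr : ∀ w ∈ r, w ∉ [i, j, p, q]) :
      aProd i j r * aProd p q l = aProd p q l * aProd i j r :=
    (commute_aProd_aProd hij hpq hne hmr hml hlr).eq
  have l12 : ∀ w ∈ l, w ∉ [x₁, y₁, x₂, y₂] := fun w hw => by simp [hl w hw]
  have l13 : ∀ w ∈ l, w ∉ [x₁, y₁, x₃, y₃] := fun w hw => by simp [hl w hw]
  have l23 : ∀ w ∈ l, w ∉ [x₂, y₂, x₃, y₃] := fun w hw => by simp [hl w hw]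
  have r12 : ∀ w ∈ r, w ∉ [x₁, y₁, x₂, y₂] := fun w hw => by simp [hr w hw]
  have r13 : ∀ w ∈ r, w ∉ [x₁, y₁, x₃, y₃] := fun w hw => by simp [hr w hw]
  have r23 : ∀ w ∈ r, w ∉ [x₂, y₂, x₃, y₃] := fun w hw => by simp [hr w hw]
  have r21 : ∀ w ∈ r, w ∉ [x₂, y₂, x₁, y₁] := fun w hw => by simp [hr w hw]
  have r31 : ∀ w ∈ r, w ∉ [x₃, y₃, x₁, y₁] := fun w hw => by simp [hr w hw]
  have r32 : ∀ w ∈ r, w ∉ [x₃, y₃, x₂, y₂] := fun w hw => by simp [hr w hw]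
  have cs {i j p q : Fin n} (hij : i ≠ j) (hpq : p ≠ q) (hne : s(i, j) ≠ s(p, q))
      (hm : ∀ w ∈ l, w ∉ [i, j, p, q]) :
      σ i j * aProd p q l = aProd p q l * σ i j :=
    (commute_σ_aProd hij hpq hne hm).eq
  have cs' {i j p q : Fin n} (hij : i ≠ j) (hpq : p ≠ q) (hne : s(i, j) ≠ s(p, q))
      (hm : ∀ w ∈ r, w ∉ [i, j, p, q]) :
      aProd p q r * σ i j = σ i j * aProd p q r :=
    (commute_σ_aProd hij hpq hne hm).eq.symm
  simp only [crossing]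
  calc _ = aProd x₁ y₁ l * σ x₁ y₁ * (aProd x₁ y₁ r * aProd x₂ y₂ l) * σ x₂ y₂ *
        (aProd x₂ y₂ r * aProd x₃ y₃ l) * σ x₃ y₃ * aProd x₃ y₃ r := by simp only [mul_assoc]
    _ = aProd x₁ y₁ l * (σ x₁ y₁ * aProd x₂ y₂ l) * (aProd x₁ y₁ r * σ x₂ y₂) *
        aProd x₃ y₃ l * (aProd x₂ y₂ r * σ x₃ y₃) * aProd x₃ y₃ r := by
        rw [ca h12 h34 n1 l12 r12, ca h34 h56 n3 l23 r23]
        simp only [mul_assoc]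
    _ = aProd x₁ y₁ l * aProd x₂ y₂ l * σ x₁ y₁ * σ x₂ y₂ * (aProd x₁ y₁ r *
        aProd x₃ y₃ l) * σ x₃ y₃ * aProd x₂ y₂ r * aProd x₃ y₃ r := by
        rw [cs h12 h34 n1 l12, cs' h34 h12 n1.symm r21,
          cs' h56 h34 n3.symm r32]
        simp only [mul_assoc]
    _ = aProd x₁ y₁ l * aProd x₂ y₂ l * σ x₁ y₁ * (σ x₂ y₂ * aProd x₃ y₃ l) * (aProd x₁ y₁ r *
        σ x₃ y₃) * aProd x₂ y₂ r * aProd x₃ y₃ r := by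
        rw [ca h12 h56 n2 l13 r13]
        simp only [mul_assoc]
    _ = aProd x₁ y₁ l * aProd x₂ y₂ l * (σ x₁ y₁ * aProd x₃ y₃ l) * σ x₂ y₂ * σ x₃ y₃ *
        aProd x₁ y₁ r * aProd x₂ y₂ r * aProd x₃ y₃ r := by
        rw [cs h34 h56 n3 l23, cs' h56 h12 n2.symm r31]
        simp only [mul_assoc]
    _ = _ := by
        rw [cs h12 h56 n2 l13]
        simp only [mul_assoc]

theorem crossing_braid {x y z : Fin n} {l r : List (Fin n)} (h : (x :: y :: z :: (l ++ r)).Nodup) :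
    crossing l (r ++ [z]) x y * crossing (y :: l) r x z * crossing l (r ++ [x]) y z =
      crossing (x :: l) r y z * crossing l (r ++ [y]) x z * crossing (z :: l) r x y := by
  have hl : (x :: y :: z :: l).Nodup := by
    simp only [List.nodup_cons, List.nodup_append, List.mem_cons, List.mem_append] at h ⊢; grind
  have hr : (x :: y :: z :: r).Nodup := by
    simp only [List.nodup_cons, List.nodup_append, List.mem_cons, List.mem_append] at h ⊢; grind
  have hlr : l.Disjoint r := by
    simp only [List.nodup_cons, List.nodup_append] at h
    intro w h1 h2
    exact h.2.2.2.2.2 w h1 w h2 rfl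
  have hA : a x y z * a x y z = 1 := a_mul_self (by simp at h ⊢; grind)
  have hσ := σ_triple (i := x) (j := y) (k := z) (by simp at h ⊢; grind)
  have hxy : x ≠ y := by simp at h; grind
  have hxz : x ≠ z := by simp at h; grind
  have hyz : y ≠ z := by simp at h; grind
  have nx : s(x, y) ≠ s(x, z) := by simp; grind
  have ny : s(x, y) ≠ s(y, z) := by simp; grind
  have nz : s(x, z) ≠ s(y, z) := by simp; grind
  have ml {w} (hw : w ∈ l) : w ≠ x ∧ w ≠ y ∧ w ≠ z := by simp at hl; grind
  have mr {w} (hw : w ∈ r) : w ≠ x ∧ w ≠ y ∧ w ≠ z := by simp at hr; grind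
  have g1 := crossing_mul_crossing_mul_crossing hxy hxz hyz nx ny nz
    (fun w hw => by have := ml hw; simp; grind)
    (fun w hw => by have := mr hw; simp; grind) hlr.symm
  have g2 := crossing_mul_crossing_mul_crossing hyz hxz hxy nz.symm ny.symm nx.symm
    (fun w hw => by have := ml hw; simp; grind)
    (fun w hw => by have := mr hw; simp; grind) hlr.symm
  have e1 : a x z y = a x y z := a_swap₂₃ _ _ _
  have e2 : a y z x = a x y z := by rw [a_swap₂₃, a_swap₁₂]
  -- The third point contributes a letter `a x y z` to each crossing. The last letter of the first
  -- crossing meets the first letter of the second and cancels; only the one at the far right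
  -- survives.
  calc _ = crossing l r x y * (a x y z * a x y z) * crossing l r x z * crossing l r y z *
        a x y z := by
        simp only [crossing, aProd_append, aProd_cons, aProd_nil, mul_one, mul_assoc, e1, e2]
    _ = a x y z * (crossing l r y z * crossing l r x z * crossing l r x y) := by
        -- With the products sorted, `a x y z` moves left through the `r`, `σ` and `l` blocks,
        -- reversing each.
        rw [hA, mul_one, g1, g2]
        rw [mul_assoc _ _ (a x y z), aProd_triple hr, ← mul_assoc _ (a x y z),
          mul_assoc _ _ (a x y z), hσ]
        have := aProd_triple hl
        simp only [← mul_assoc] at this ⊢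
        rw [this]
    _ = a x y z * crossing l r y z * crossing l r x z * (a x y z * a x y z) *
        crossing l r x y := by rw [hA, mul_one]; simp only [mul_assoc]
    _ = _ := by
        simp only [crossing, aProd_append, aProd_cons, aProd_nil, mul_one, mul_assoc, e1, e2]

/-! #### Distant crossings commute -/

/-- Neither `r` nor `s` lies in a triple of the first product, so two triples can meet only in the
third point of the second. That point may be `p` or `q`, or occur in both lists. -/
theorem commute_aProd_aProd_of_nodup {p q r s : Fin n} {l l' : List (Fin n)}
    (h : [p, q, r, s].Nodup) (hl : ∀ w ∈ l, w ∉ [p, q, r, s]) (hl' : ∀ w ∈ l', w ∉ [r, s]) :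
    Commute (aProd p q l) (aProd r s l') := by
  refine commute_aProd fun v hv => (commute_aProd fun w hw => Commute.symm ?_).symm
  have hw := hl w hw
  have hv := hl' v hv
  simp only [List.nodup_cons, List.mem_cons, List.not_mem_nil, or_false, not_or] at h hw hv
  refine commute_a_a (by simp; grind) (by simp; grind)
    (Nat.lt_succ_of_le (Finset.card_le_one.2 ?_))
  simp only [Finset.mem_inter, Finset.mem_insert, Finset.mem_singleton]
  grind

theorem commute_σ_aProd_of_nodup {p q r s : Fin n} {l : List (Fin n)}
    (h : [p, q, r, s].Nodup) (hl : ∀ w ∈ l, w ∉ [r, s]) :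
    Commute (σ p q) (aProd r s l) := by
  refine commute_aProd fun v hv => ?_
  have hv := hl v hv
  simp only [List.nodup_cons, List.mem_cons, List.not_mem_nil, or_false, not_or] at h hv
  refine commute_σ_a h.1.1 (by simp; grind) (card_pair_inter_lt_two ?_)
  simp only [Finset.mem_insert, Finset.mem_singleton]
  grind

/-- Two words commute up to a change in their central blocks: every other pair of blocks commutes,
and `h` exchanges the central ones. -/
theorem mul_exchange {G : Type*} [Group G] {A B C D u u' v v' : G} (hAC : Commute A C)
    (hAv : Commute A v') (hAD : Commute A D) (hBC : Commute B C) (hBv : Commute B v)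
    (hBD : Commute B D) (huC : Commute u C) (huD : Commute u' D) (h : u * v = v' * u') :
    A * u * B * (C * v * D) = C * v' * D * (A * u' * B) := by
  calc _ = A * u * (B * (C * v * D)) := by simp only [mul_assoc]
    _ = A * (u * C) * (v * D) * B := by
        rw [((hBC.mul_right hBv).mul_right hBD).eq]; simp only [mul_assoc]
    _ = (A * C) * (u * v) * D * B := by rw [huC.eq]; simp only [mul_assoc]
    _ = C * (A * v') * (u' * D) * B := by rw [hAC.eq, h]; simp only [mul_assoc]
    _ = C * v' * (A * D) * u' * B := by rw [hAv.eq, huD.eq]; simp only [mul_assoc]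
    _ = _ := by rw [hAD.eq]; simp only [mul_assoc]

theorem crossing_comm {p q r s : Fin n} {l m u : List (Fin n)}
    (h : (p :: q :: r :: s :: (l ++ m ++ u)).Nodup) :
    crossing l (u ++ [s, r] ++ m) p q * crossing (m ++ [p, q] ++ l) u r s =
      crossing (m ++ [q, p] ++ l) u r s * crossing l (u ++ [r, s] ++ m) p q := by
  have nd : [p, q, r, s].Nodup := by simp at h ⊢; grind
  have nd' : [r, s, p, q].Nodup := by simp at h ⊢; grind
  have hm {w} (hw : w ∈ l ++ m ++ u) : w ≠ p ∧ w ≠ q ∧ w ≠ r ∧ w ≠ s := by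
    simp at h hw ⊢; grind
  have hn {w} (hw : w ∈ [p, q]) : w ∉ [r, s] := by simp at nd hw ⊢; grind
  have hn' {w} (hw : w ∈ [r, s]) : w ∉ [p, q] := by simp at nd hw ⊢; grind
  have caa {k k' : List (Fin n)} (hk : k ⊆ l ++ m ++ u) (hk' : ∀ w ∈ k', w ∉ [r, s]) :
      Commute (aProd p q k) (aProd r s k') :=
    commute_aProd_aProd_of_nodup nd (fun w hw => by simp [hm (hk hw)]) hk'
  have caa' {k k' : List (Fin n)} (hk : k ⊆ l ++ m ++ u) (hk' : ∀ w ∈ k', w ∉ [p, q]) :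
      Commute (aProd p q k') (aProd r s k) :=
    (commute_aProd_aProd_of_nodup nd' (fun w hw => by simp [hm (hk hw)]) hk').symm
  have csa {k : List (Fin n)} (hk' : ∀ w ∈ k, w ∉ [r, s]) : Commute (σ p q) (aProd r s k) :=
    commute_σ_aProd_of_nodup nd hk'
  have csa' {k : List (Fin n)} (hk' : ∀ w ∈ k, w ∉ [p, q]) : Commute (aProd p q k) (σ r s) :=
    (commute_σ_aProd_of_nodup nd' hk').symm
  have hlu : l ⊆ l ++ m ++ u := fun w hw => by simp [hw]
  have hmu : m ⊆ l ++ m ++ u := fun w hw => by simp [hw]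
  have huu : u ⊆ l ++ m ++ u := fun w hw => by simp [hw]
  have z {k : List (Fin n)} (hk : k ⊆ l ++ m ++ u) : ∀ w ∈ k, w ∉ [r, s] :=
    fun w hw => by simp [hm (hk hw)]
  have z' {k : List (Fin n)} (hk : k ⊆ l ++ m ++ u) : ∀ w ∈ k, w ∉ [p, q] :=
    fun w hw => by simp [hm (hk hw)]
  have nA {k : List (Fin n)} (hk : ∀ w ∈ k, w ∉ [r, s]) :
      Commute (aProd p q l * σ p q * aProd p q u) (aProd r s k) :=
    ((caa hlu hk).mul_left (csa hk)).mul_left (caa huu hk)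
  have e1 : a r s p = a p r s := by rw [a_swap₂₃, a_swap₁₂]
  have e2 : a r s q = a q r s := by rw [a_swap₂₃, a_swap₁₂]
  -- The only letters that fail to commute: each of these triples contains one of the pairs and a
  -- point of the other.
  have T : a p q s * a p q r * (a r s p * a r s q) = a r s q * a r s p * (a p q r * a p q s) := by
    have := tetrahedron (i := p) (j := q) (k := s) (l := r) (by simp at nd ⊢; grind)
    rw [a_swap₂₃ p s r, a_swap₂₃ q s r] at this
    rw [e1, e2]
    simpa only [mul_assoc] using this
  have key := mul_exchange (A := aProd p q l * σ p q * aProd p q u) (u := aProd p q [s, r])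
    (B := aProd p q m) (C := aProd r s m) (v := aProd r s [p, q]) (v' := aProd r s [q, p])
    (D := aProd r s l * σ r s * aProd r s u) (u' := aProd p q [r, s])
    (nA (z hmu)) (nA fun w hw => hn (by simp at hw ⊢; tauto))
    (((nA (z hlu)).mul_right (((csa' (z' hlu)).mul_left (commute_σ_σ nd)).mul_left
      (csa' (z' huu)))).mul_right (nA (z huu)))
    (caa hmu (z hmu)) (caa hmu fun w hw => hn hw)
    (((caa hmu (z hlu)).mul_right (csa' (z' hmu))).mul_right (caa hmu (z huu)))
    (caa' hmu fun w hw => hn' (by simp at hw ⊢; tauto))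
    (((caa' hlu fun w hw => hn' hw).mul_right (csa' fun w hw => hn' hw)).mul_right
      (caa' huu fun w hw => hn' hw))
    (by simpa using T)
  simp only [crossing, aProd_append]
  simpa only [mul_assoc] using key

/-! #### Index lists -/

/-- A strictly increasing list is determined by its members, which reduces the identities between
index lists to arithmetic. -/
theorem pairwise_filter_finRange (p : Fin n → Bool) :
    ((List.finRange n).filter p).Pairwise (· < ·) :=
  (List.pairwise_lt_finRange n).filter p

theorem pairwise_below (i j : Fin n) : (below i j).Pairwise (· < ·) := pairwise_filter_finRange _

theorem pairwise_above (j : Fin n) : (above j).Pairwise (· < ·) := pairwise_filter_finRange _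

theorem pairwise_between (i j : Fin n) : (between i j).Pairwise (· < ·) :=
  pairwise_filter_finRange _

@[simp] theorem mem_below {i j k : Fin n} : k ∈ below i j ↔ k < j ∧ k ≠ i := by simp [below]

@[simp] theorem mem_above {j k : Fin n} : k ∈ above j ↔ j < k := by simp [above]

@[simp] theorem mem_between {i j k : Fin n} : k ∈ between i j ↔ i < k ∧ k < j := by simp [between]

theorem map_swap_eq_self {x y : Fin n} {l : List (Fin n)} (hx : x ∉ l) (hy : y ∉ l) :
    l.map (Equiv.swap x y) = l :=
  (List.map_congr_left fun _ hw => Equiv.swap_apply_of_ne_of_ne (ne_of_mem_of_not_mem hw hx)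
    (ne_of_mem_of_not_mem hw hy)).trans (List.map_id' l)

theorem cbar_eq_crossing (i j : Fin n) :
    cbar i j = crossing (below i j).reverse (above j).reverse i j := rfl

/-- The letters `a` are involutions, so inversion only reverses their order and inverts `σ`. -/
theorem c_inv {i j : Fin n} (h : i < j) : (c i j)⁻¹ = cbar i j := by
  have hb : (aProd i j (below i j))⁻¹ = aProd i j (below i j).reverse :=
    aProd_inv fun k hk => by simp at hk ⊢; grind
  have ha : (aProd i j (above j))⁻¹ = aProd i j (above j).reverse :=
    aProd_inv fun k hk => by simp at hk ⊢; grind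
  rw [cbar_eq_crossing, crossing, ← hb, ← ha, c, ← aProd, ← aProd]
  group

theorem cbarSwap_eq_crossing (i j : Fin n) :
    cbarSwap i j = crossing (below i j).reverse (above j).reverse j i := by
  rw [crossing, aProd_comm j i, aProd_comm j i]
  rfl

/-! ### Artin's relations for crossings of neighbouring positions -/

section position

variable {p q r s : Fin n}

theorem nodup_below (i j : Fin n) : (below i j).Nodup := (pairwise_below i j).imp ne_of_lt

theorem nodup_above (j : Fin n) : (above j).Nodup := (pairwise_above j).imp ne_of_lt

theorem nodup_between (i j : Fin n) : (between i j).Nodup := (pairwise_between i j).imp ne_of_lt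

theorem above_eq_cons (hq : q.val + 1 = r.val) : above q = r :: above r := by
  refine List.Pairwise.eq_of_mem_iff (pairwise_above _) ?_ fun x => ?_
  · simp [pairwise_above]
  · simp only [mem_above, List.mem_cons]; omega

theorem below_eq_append (hp : p.val + 1 = q.val) (hq : q.val + 1 = r.val) :
    below q r = below p q ++ [p] := by
  refine List.Pairwise.eq_of_mem_iff (pairwise_below _ _) ?_ fun x => ?_
  · simp only [List.pairwise_append, pairwise_below, List.pairwise_singleton, mem_below,
      List.mem_singleton, true_and]
    omega
  · simp only [mem_below, List.mem_append, List.mem_singleton]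
    omega

theorem above_eq_between_append (hq : q < r) (hr : r.val + 1 = s.val) :
    above q = between q r ++ r :: s :: above s := by
  rw [← above_eq_cons hr]
  refine List.Pairwise.eq_of_mem_iff (pairwise_above _) ?_ fun x => ?_
  · simp only [List.pairwise_append, pairwise_between, List.pairwise_cons, mem_between,
      List.mem_cons, true_and, pairwise_above, mem_above, and_true, imp_self, implies_true]
    omega
  · simp only [mem_above, mem_between, List.mem_append, List.mem_cons]
    omega

theorem below_eq_append_between (hp : p.val + 1 = q.val) (hq : q < r) (hr : r.val + 1 = s.val) :
    below r s = below p q ++ p :: q :: between q r := by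
  refine List.Pairwise.eq_of_mem_iff (pairwise_below _ _) ?_ fun x => ?_
  · simp only [List.pairwise_append, pairwise_between, pairwise_below, List.pairwise_cons,
      mem_between, mem_below, List.mem_cons, true_and, and_true]
    refine ⟨⟨?_, ?_⟩, ?_⟩ <;> omega
  · simp only [mem_below, mem_between, List.mem_append, List.mem_cons]
    omega

theorem between_eq_append {i : Fin n} (hi : i < p) (hp : p.val + 1 = q.val) :
    between i q = between i p ++ [p] := by
  refine List.Pairwise.eq_of_mem_iff (pairwise_between _ _) ?_ fun x => ?_
  · simp only [List.pairwise_append, pairwise_between, List.pairwise_singleton, mem_between,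
      List.mem_singleton, true_and]
    omega
  · simp only [mem_between, List.mem_append, List.mem_singleton]
    omega

/-- This is the first component of the braid relation in the semidirect product. Renaming replaces
positions by labels and fixes the points outside `p, q, r`, which leaves `crossing_braid`. -/
theorem cbar_braid (hp : p.val + 1 = q.val) (hq : q.val + 1 = r.val) :
    cbar p q * rename n (Equiv.swap p q) (cbar q r) *
        rename n (Equiv.swap p q * Equiv.swap q r) (cbar p q) =
      cbar q r * rename n (Equiv.swap q r) (cbar p q) *
        rename n (Equiv.swap q r * Equiv.swap p q) (cbar q r) := by
  have hpq : p ≠ q := by rw [ne_eq, Fin.ext_iff]; omega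
  have hpr : p ≠ r := by rw [ne_eq, Fin.ext_iff]; omega
  have hqr : q ≠ r := by rw [ne_eq, Fin.ext_iff]; omega
  have nd : (p :: q :: r :: ((below p q).reverse ++ (above r).reverse)).Nodup := by
    simp only [List.nodup_cons, List.nodup_append, List.nodup_reverse, List.mem_cons,
      List.mem_append, List.mem_reverse, mem_below, mem_above, nodup_below, nodup_above,
      true_and]
    refine ⟨?_, ?_, ?_, ?_⟩ <;> omega
  have fix {x y : Fin n} (hx : x ∈ [p, q, r]) (hy : y ∈ [p, q, r]) :
      (below p q).reverse.map (Equiv.swap x y) = (below p q).reverse ∧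
      (above r).reverse.map (Equiv.swap x y) = (above r).reverse := by
    constructor <;> apply map_swap_eq_self <;> simp at hx hy nd ⊢ <;> grind
  have f1 := fix (x := p) (y := q) (by simp) (by simp)
  have f2 := fix (x := q) (y := r) (by simp) (by simp)
  simp only [cbar_eq_crossing, above_eq_cons hq, below_eq_append hp hq, map_mul, MulAut.mul_apply,
    rename_crossing, List.reverse_cons, List.reverse_append, List.map_append, List.map_cons,
    List.map_nil, f1.1, f1.2, f2.1, f2.2, Equiv.swap_apply_left, Equiv.swap_apply_right,
    Equiv.swap_apply_of_ne_of_ne hpr.symm hqr.symm, Equiv.swap_apply_of_ne_of_ne hpq hpr,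
    List.reverse_nil, List.nil_append, List.cons_append]
  exact crossing_braid nd

/-- The first component of far commutativity. The renaming matters: each crossing sees the other
pair in its current order, as `crossing_comm` requires. -/
theorem cbar_comm (hp : p.val + 1 = q.val) (hq : q < r) (hr : r.val + 1 = s.val) :
    cbar p q * rename n (Equiv.swap p q) (cbar r s) =
      cbar r s * rename n (Equiv.swap r s) (cbar p q) := by
  have nd : (p :: q :: r :: s :: ((below p q).reverse ++ (between q r).reverse ++
      (above s).reverse)).Nodup := by
    simp only [List.nodup_cons, List.nodup_append, List.nodup_reverse, List.mem_cons,
      List.mem_append, List.mem_reverse, mem_below, mem_above, mem_between, nodup_below,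
      nodup_above, nodup_between, true_and]
    refine ⟨?_, ?_, ?_, ?_, ?_, ?_⟩ <;> omega
  have hpr : r ≠ p ∧ r ≠ q ∧ s ≠ p ∧ s ≠ q := by simp at nd; grind
  have fix {x y : Fin n} (hx : x ∈ [p, q, r, s]) (hy : y ∈ [p, q, r, s]) :
      (below p q).reverse.map (Equiv.swap x y) = (below p q).reverse ∧
      (between q r).reverse.map (Equiv.swap x y) = (between q r).reverse ∧
      (above s).reverse.map (Equiv.swap x y) = (above s).reverse := by
    refine ⟨?_, ?_, ?_⟩ <;> apply map_swap_eq_self <;> simp at hx hy nd ⊢ <;> grind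
  have f1 := fix (x := p) (y := q) (by simp) (by simp)
  have f2 := fix (x := r) (y := s) (by simp) (by simp)
  have key := crossing_comm nd
  simp only [List.append_assoc, List.cons_append, List.nil_append] at key
  simpa only [cbar_eq_crossing, above_eq_between_append hq hr, below_eq_append_between hp hq hr,
    rename_crossing, List.reverse_cons, List.reverse_append, List.map_append, List.map_cons,
    List.map_nil, f1.1, f1.2.1, f1.2.2, f2.1, f2.2.1, f2.2.2, Equiv.swap_apply_left,
    Equiv.swap_apply_right, Equiv.swap_apply_of_ne_of_ne hpr.1 hpr.2.1,
    Equiv.swap_apply_of_ne_of_ne hpr.2.2.1 hpr.2.2.2, List.append_assoc,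
    Equiv.swap_apply_of_ne_of_ne hpr.1.symm hpr.2.2.1.symm,
    Equiv.swap_apply_of_ne_of_ne hpr.2.1.symm hpr.2.2.2.symm,
    List.reverse_nil, List.nil_append, List.cons_append] using key

end position

end TildeG

namespace BraidGroup

open TildeG

variable {n : ℕ}

/-! #### The extension of the homomorphism to the whole braid group -/

/-- The image of the Artin generator `s_k` in the semidirect product. -/
def twistedCrossing (k : Fin (n - 1)) : TildeG n ⋊[rename n] Equiv.Perm (Fin n) :=
  ⟨cbar ⟨k.val, by omega⟩ ⟨k.val + 1, by omega⟩, adjSwap k⟩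

theorem twistedCrossing_rel (r : FreeGroup (Fin (n - 1))) (hr : r ∈ {r | BraidRel n r}) :
    FreeGroup.lift (twistedCrossing (n := n)) r = 1 := by
  have hperm := adjSwap_rel r hr
  rcases hr with ⟨k, l, h⟩ | ⟨k, l, h⟩ <;>
  simp only [map_mul, map_inv, FreeGroup.lift_apply_of, mul_inv_eq_one] at hperm ⊢ <;>
  refine SemidirectProduct.ext ?_ hperm
  · exact cbar_comm (p := ⟨k.val, by omega⟩) (r := ⟨l.val, by omega⟩) rfl
      (by rw [Fin.lt_def]; exact h) rfl
  · obtain ⟨l, hl⟩ := l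
    subst h
    exact cbar_braid (p := ⟨k.val, by omega⟩) rfl rfl

/-- The homomorphism from the braid group to the semidirect product of `TildeG n` and the
symmetric group. -/
def twistedHom (n : ℕ) : BraidGroup n →* TildeG n ⋊[rename n] Equiv.Perm (Fin n) :=
  PresentedGroup.toGroup twistedCrossing_rel

theorem twistedHom_s (k : Fin (n - 1)) : twistedHom n (s k) = twistedCrossing k :=
  PresentedGroup.toGroup.of _

theorem twistedHom_right (x : BraidGroup n) : (twistedHom n x).right = perm n x := by
  have : SemidirectProduct.rightHom.comp (twistedHom n) = perm n := by
    refine PresentedGroup.ext fun k => ?_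
    simp only [MonoidHom.comp_apply, twistedHom, perm, PresentedGroup.toGroup.of]
    rfl
  exact DFunLike.congr_fun this x

/-- The homomorphism from the pure braid group to `TildeG n`. -/
def pureHom (n : ℕ) : PureBraidGroup n →* TildeG n where
  toFun x := (twistedHom n x).left
  map_one' := by simp
  -- The twist in the first component is by the permutation of `x`, which is trivial.
  map_mul' x y := by
    simp [twistedHom_right, MonoidHom.mem_ker.1 x.2]

/-! #### The images of the generators -/

theorem run_succ_self (i : Fin n) (h : i.val + 1 < n) : run i ⟨i.val + 1, h⟩ = 1 := by
  rw [run, List.filter_eq_nil_iff.2 (by simp)]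
  rfl

theorem run_succ (i : Fin n) (k : ℕ) (hk : k + 1 < n) (hi : i.val < k) :
    run i ⟨k + 1, hk⟩ = run i ⟨k, by omega⟩ * s ⟨k - 1, by omega⟩ := by
  have : (List.finRange (n - 1)).filter (fun m => i.val ≤ m.val ∧ m.val + 1 < k + 1) =
      (List.finRange (n - 1)).filter (fun m => i.val ≤ m.val ∧ m.val + 1 < k) ++
        [⟨k - 1, by omega⟩] := by
    refine List.Pairwise.eq_of_mem_iff (pairwise_filter_finRange _) ?_ fun x => ?_
    · rw [List.pairwise_append]
      refine ⟨pairwise_filter_finRange _, List.pairwise_singleton _ _, ?_⟩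
      simp only [List.mem_filter, List.mem_finRange, decide_eq_true_eq, List.mem_singleton,
        Fin.lt_def]
      rintro a ha b rfl
      simp only
      omega
    · simp only [List.mem_filter, List.mem_finRange, decide_eq_true_eq, List.mem_singleton,
        List.mem_append, Fin.ext_iff, true_and]
      omega
  simp only [run, this, List.map_append, List.prod_append]
  simp

/-- The permutation `π` moves the value `i` to the position `k` and keeps the order of the other
values. -/
def IsShift (π : Equiv.Perm (Fin n)) (i k : Fin n) : Prop :=
  ∀ w, (π w).val = if w < i then w.val else if w < k then w.val + 1 else if w = k then i else w

/-- Away from the position `p` a shift is increasing, so it carries the sorted list of the other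
positions below `q` to a sorted list with the right members. -/
theorem IsShift.map_below {π : Equiv.Perm (Fin n)} {i p q : Fin n} (h : IsShift π i p)
    (hi : i ≤ p) (hp : p.val + 1 = q.val) : (below p q).map π = below i q := by
  refine List.Pairwise.eq_of_mem_iff ?_ (pairwise_below _ _) fun x => ?_
  · rw [List.pairwise_map]
    refine (pairwise_below p q).imp_of_mem fun {a b} ha hb hab => ?_
    have h1 := h a
    have h2 := h b
    simp only [mem_below] at ha hb
    grind
  · simp only [List.mem_map, mem_below]
    constructor
    · rintro ⟨w, hw, rfl⟩
      have := h w
      grind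
    · rintro hx
      refine ⟨π.symm x, ?_, by simp⟩
      have := h (π.symm x)
      rw [Equiv.apply_symm_apply] at this
      grind

theorem IsShift.map_above {π : Equiv.Perm (Fin n)} {i p q : Fin n} (h : IsShift π i p)
    (hp : p.val + 1 = q.val) : (above q).map π = above q := by
  refine (List.map_congr_left fun w hw => ?_).trans (List.map_id _)
  have := h w
  simp only [mem_above] at hw
  rw [id, Fin.ext_iff]
  grind

theorem IsShift.apply_self {π : Equiv.Perm (Fin n)} {i p : Fin n} (h : IsShift π i p)
    (hi : i ≤ p) : π p = i := by
  have := h p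
  rw [Fin.ext_iff]
  grind

theorem IsShift.apply_succ {π : Equiv.Perm (Fin n)} {i p q : Fin n} (h : IsShift π i p)
    (hp : p.val + 1 = q.val) : π q = q := by
  have := h q
  rw [Fin.ext_iff]
  grind

theorem IsShift.rename_cbar {π : Equiv.Perm (Fin n)} {i p q : Fin n} (h : IsShift π i p)
    (hi : i ≤ p) (hp : p.val + 1 = q.val) : rename n π (cbar p q) = cbar i q := by
  rw [cbar_eq_crossing, rename_crossing, List.map_reverse, List.map_reverse, h.map_below hi hp,
    h.map_above hp, h.apply_self hi, h.apply_succ hp, cbar_eq_crossing]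

/-- The second half of the full turn: the points at `p` and `q` have already changed places, so `σ`
gets its indices in the opposite order. -/
theorem IsShift.rename_cbarSwap {π : Equiv.Perm (Fin n)} {i p q : Fin n} (h : IsShift π i p)
    (hi : i ≤ p) (hp : p.val + 1 = q.val) :
    rename n π (rename n (Equiv.swap p q) (cbar p q)) = cbarSwap i q := by
  have hb : (below p q).reverse.map (Equiv.swap p q) = (below p q).reverse := by
    apply map_swap_eq_self <;> simp
  have ha : (above q).reverse.map (Equiv.swap p q) = (above q).reverse := by
    apply map_swap_eq_self <;> simp; omega
  rw [cbar_eq_crossing, rename_crossing, ha, hb, Equiv.swap_apply_left, Equiv.swap_apply_right,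
    rename_crossing, List.map_reverse, List.map_reverse, h.map_below hi hp,
    h.map_above hp, h.apply_self hi, h.apply_succ hp, cbarSwap_eq_crossing]

theorem IsShift.mul_swap {π : Equiv.Perm (Fin n)} {i p q : Fin n} (h : IsShift π i p)
    (hi : i ≤ p) (hp : p.val + 1 = q.val) : IsShift (π * Equiv.swap p q) i q := by
  intro w
  rw [Equiv.Perm.mul_apply]
  rcases eq_or_ne w p with rfl | hwp
  · rw [Equiv.swap_apply_left, h.apply_succ hp]
    grind
  rcases eq_or_ne w q with rfl | hwq
  · rw [Equiv.swap_apply_right, h.apply_self hi]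
    grind
  · rw [Equiv.swap_apply_of_ne_of_ne hwp hwq, h w]
    grind

theorem isShift_one (i : Fin n) : IsShift 1 i i := by
  intro w
  rw [Equiv.Perm.one_apply]
  grind

/-- Both components are needed together in the induction: the shift reached so far determines the
label under which the next crossing is recorded. -/
theorem twistedHom_run (i : Fin n) (k : ℕ) (hi : i.val ≤ k) (hk : k + 1 < n) :
    (twistedHom n (run i ⟨k + 1, hk⟩)).left = ((between i ⟨k + 1, hk⟩).map (cbar i)).prod ∧
      IsShift (twistedHom n (run i ⟨k + 1, hk⟩)).right i ⟨k, by omega⟩ := by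
  induction k, hi using Nat.le_induction with
  | base =>
    have : between i ⟨i.val + 1, hk⟩ = [] := by
      refine List.eq_nil_iff_forall_not_mem.2 fun x => ?_
      simp only [mem_between, Fin.lt_def]
      omega
    rw [run_succ_self, map_one, this]
    exact ⟨rfl, isShift_one i⟩
  | succ k hi ih =>
    obtain ⟨hl, hr⟩ := ih (by omega)
    have hi' : i ≤ ⟨k, by omega⟩ := hi
    have e := run_succ i (k + 1) hk (by omega)
    rw [e, map_mul, twistedHom_s, SemidirectProduct.mul_left, SemidirectProduct.mul_right, hl]
    constructor
    · rw [between_eq_append (p := ⟨k + 1, by omega⟩) (q := ⟨k + 1 + 1, hk⟩)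
        (by rw [Fin.lt_def]; exact Nat.lt_succ_of_le hi) rfl, List.map_append, List.prod_append, List.map_singleton, List.prod_singleton]
      exact congrArg _ (hr.rename_cbar hi' rfl)
    · exact hr.mul_swap hi' rfl

theorem twistedHom_b {i j : Fin n} (h : i < j) : (twistedHom n (b i j h)).left = phi i j := by
  obtain ⟨_ | k, hk⟩ := j
  · exact absurd h (Nat.not_lt_zero _)
  have hi : i.val ≤ k := Nat.le_of_lt_succ h
  obtain ⟨hl, hr⟩ := twistedHom_run i k hi hk
  have hi' : i ≤ ⟨k, by omega⟩ := hi
  -- The conjugating prefix is a product of `cbar`, while `phi` is written with the inverses of `c`.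
  have hc : (between i ⟨k + 1, hk⟩).map (cbar i) =
      (between i ⟨k + 1, hk⟩).map fun m => (c i m)⁻¹ :=
    List.map_congr_left fun m hm => (c_inv (mem_between.1 hm).1).symm
  have hinv : ((between i ⟨k + 1, hk⟩).map fun m => (c i m)⁻¹).prod⁻¹ =
      ((between i ⟨k + 1, hk⟩).reverse.map fun m => c i m).prod := by
    rw [List.prod_inv_reverse, List.map_map, List.map_reverse]
    congr 2
    exact List.map_congr_left fun m _ => inv_inv _
  rw [hc] at hl
  have hs := twistedHom_s (n := n) ⟨k, by omega⟩
  have hsq : adjSwap (n := n) ⟨k, by omega⟩ * adjSwap ⟨k, by omega⟩ = 1 := Equiv.swap_mul_self _ _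
  have e1 := hr.rename_cbar hi' (q := ⟨k + 1, hk⟩) rfl
  have e2 := hr.rename_cbarSwap hi' (q := ⟨k + 1, hk⟩) rfl
  simp only [b, Nat.add_sub_cancel, map_mul, map_inv, pow_two, hs, SemidirectProduct.mul_left,
    SemidirectProduct.mul_right, SemidirectProduct.inv_left]
  rw [hl, phi, ← hinv, ← e1, ← e2]
  -- Since the transposition squares to 1, the permutation before the final inverse is that of the
  -- prefix; it cancels the inverse permutation twisting the inverted prefix.
  simp only [twistedCrossing, hsq, mul_one, ← MulAut.mul_apply, mul_inv_cancel, MulAut.one_apply,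
    mul_assoc, ← map_mul]
  rfl

theorem pureHom_b {i j : Fin n} (h : i < j) : pureHom n (PureBraidGroup.b i j h) = phi i j :=
  twistedHom_b h

end BraidGroup

theorem theorem1 (n : ℕ) :
    (∃ f : PureBraidGroup n →* TildeG n,
      ∀ (i j : Fin n) (h : i < j), f (PureBraidGroup.b i j h) = TildeG.phi i j) ∧
    (∀ w w' : FreeGroup {p : Fin n × Fin n // p.1 < p.2},
      FreeGroup.lift (fun p => PureBraidGroup.b p.1.1 p.1.2 p.2) w =
        FreeGroup.lift (fun p => PureBraidGroup.b p.1.1 p.1.2 p.2) w' →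
      FreeGroup.lift (fun p => TildeG.phi p.1.1 p.1.2) w =
        FreeGroup.lift (fun p => TildeG.phi p.1.1 p.1.2) w') := by
  refine ⟨⟨BraidGroup.pureHom n, fun i j h => BraidGroup.pureHom_b h⟩, fun w w' h => ?_⟩
  -- Substitution into words factors through the pure braid group, so it respects equality there.
  have key : (BraidGroup.pureHom n).comp
      (FreeGroup.lift fun p : {p : Fin n × Fin n // p.1 < p.2} =>
        PureBraidGroup.b p.1.1 p.1.2 p.2) =
      FreeGroup.lift fun p => TildeG.phi p.1.1 p.1.2 := by
    ext p
    simp [BraidGroup.pureHom_b]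
  rw [← key, MonoidHom.comp_apply, MonoidHom.comp_apply, h]
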